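/- Let $X$ be a locally finite, connected graph, possibly with multiple edges and loops. For vertices $x \ne y$ let $e(x,y)$ be the number of edges between $x$ and $y$, let $e(x,x)$ be twice the number of loops at $x$, and let $\deg(x) = \sum_y e(x,y)$. Assume that $\deg(x) \ge 2$ for every vertex $x$. Each edge, loops included, gives two oppositely oriented edges; let $E(X)$ be the set of oriented edges, so that $|E(X)|$ is twice the number of unoriented edges. The non-backtracking random walk started at a vertex $x$ first traverses an oriented edge chosen uniformly among those that start at $x$. After traversing an oriented edge $e$, it next traverses an oriented edge chosen uniformly among those that start at the terminal vertex of $e$ and are different from the reversal of $e$. Let $q^{(n)}(x,y)$ be the probability that the walk started at $x$ is at $y$ after $n$ steps. (a) If $X$ is finite, then for all vertices $x,y$, $$\lim_{n\to\infty} \frac1n \sum_{k=1}^n q^{(k)}(x,y) = \frac{\deg(y)}{|E(X)|}.$$ (b) If $X$ is finite and $\deg(v) \ge 3$ for every vertex $v$, then for all vertices $x,y$, $$\lim_{n\to\infty} q^{(n)}(x,y) = \frac{\deg(y)}{|E(X)|} \quad\text{if } X \text{ is not bipartite},$$ $$\lim_{n\to\infty} q^{(2n+\delta)}(x,y) = \frac{2\deg(y)}{|E(X)|}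 \quad\text{if } X \text{ is bipartite},$$ where $\delta = 0$ if the distance between $x$ and $y$ is even and $\delta = 1$ if it is odd. (c) If $X$ is infinite, then $\lim_{n\to\infty} q^{(n)}(x,y) = 0$ for all vertices $x,y$. -/

import Mathlib

open scoped Graph

noncomputable section

namespace NBRW

/-- The number `e(x,y)` of edges between two vertices of a multigraph, where the loops at `x`
are counted twice in `e(x,x)`. -/
def edgeCount {α β : Type*} (G : Graph α β) (x y : V(G)) : ℕ :=
  open Classical in
  if x = y then 2 * {e : β | G.IsLoopAt e x}.ncard else {e : β | G.IsLink e x y}.ncard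

/-- The degree `deg(x) = ∑_y e(x,y)`; a finite sum in a locally finite graph. -/
def deg {α β : Type*} (G : Graph α β) (x : V(G)) : ℕ := ∑ᶠ y : V(G), edgeCount G x y

/-- Every vertex is incident with only finitely many edges. -/
def LocallyFinite {α β : Type*} (G : Graph α β) : Prop :=
  ∀ x : V(G), (G.incidenceSet x).Finite

/-- Every vertex has degree at least `k`. -/
def MinDegreeAtLeast {α β : Type*} (G : Graph α β) (k : ℕ) : Prop :=
  ∀ x : V(G), k ≤ deg G x

/-- The simple graph on the vertex set in which two distinct vertices are adjacent when some
edge joins them. It has the same connectedness and the same graph distance as `G`. -/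
def underlying {α β : Type*} (G : Graph α β) : SimpleGraph V(G) where
  Adj x y := x ≠ y ∧ G.Adj x y
  symm := ⟨fun _ _ h => ⟨h.1.symm, h.2.symm⟩⟩
  loopless := ⟨fun _ h => h.1 rfl⟩

/-- The graph is nonempty and any two vertices are joined by a path. -/
def Connected {α β : Type*} (G : Graph α β) : Prop := (underlying G).Connected

/-- The graph distance, the minimum length of a path from `x` to `y`. -/
def dist {α β : Type*} (G : Graph α β) (x y : V(G)) : ℕ := (underlying G).dist x y

/-- The vertices can be coloured with two colours such that the ends of every edge have
different colours (so there are no loops). -/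
def Bipartite {α β : Type*} (G : Graph α β) : Prop :=
  ∃ c : V(G) → Bool, ∀ x y : V(G), G.Adj x y → c x ≠ c y

/-- Oriented edges: an edge joining two distinct vertices gives one oriented edge in each
direction, and a loop also gives two oriented edges, told apart by a Boolean. -/
inductive OEdge {α β : Type*} (G : Graph α β)
  | arc (e : β) (x y : V(G)) (hne : x ≠ y) (h : G.IsLink e x y) : OEdge G
  | loop (e : β) (x : V(G)) (h : G.IsLoopAt e x) (side : Bool) : OEdge G

namespace OEdge

variable {α β : Type*} {G : Graph α β}

/-- The initial vertex. -/
def tail : OEdge G → V(G)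
  | arc _ x _ _ _ => x
  | loop _ x _ _ => x

/-- The terminal vertex. -/
def head : OEdge G → V(G)
  | arc _ _ y _ _ => y
  | loop _ x _ _ => x

/-- The same edge with the opposite orientation. -/
def rev : OEdge G → OEdge G
  | arc e x y hne h => arc e y x hne.symm h.symm
  | loop e x h side => loop e x h (!side)

/-- The underlying unoriented edge. -/
def edge : OEdge G → β
  | arc e _ _ _ _ => e
  | loop e _ _ _ => e

/-- The Boolean of an oriented loop, and `false` for other edges. -/
def side : OEdge G → Bool
  | arc _ _ _ _ _ => false
  | loop _ _ _ side => side

theorem isLink : ∀ f : OEdge G, G.IsLink f.edge f.tail f.head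
  | arc _ _ _ _ h => h
  | loop _ _ h _ => h

theorem eq_of_tail_edge_side {f g : OEdge G} (ht : f.tail = g.tail) (he : f.edge = g.edge)
    (hs : f.side = g.side) : f = g := by
  have hh : f.head = g.head := by
    have h1 := f.isLink
    have h2 := g.isLink
    rw [ht, he] at h1
    exact Subtype.ext (h1.right_unique h2)
  cases f <;> cases g <;> simp only [tail, edge, side, head] at * <;> grind

end OEdge

/-- The oriented edges with initial vertex `x`. -/
def outSet {α β : Type*} (G : Graph α β) (x : V(G)) : Set (OEdge G) := {f | f.tail = x}

/-- The oriented edges `f` with `e → f`: they start where `e` ends, and `f` is not the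
reversal of `e`. -/
def nextSet {α β : Type*} {G : Graph α β} (e : OEdge G) : Set (OEdge G) :=
  {f | f.tail = e.head ∧ f ≠ e.rev}

section Finiteness

variable {α β : Type*} {G : Graph α β}

theorem outSet_finite (hf : LocallyFinite G) (x : V(G)) : (outSet G x).Finite := by
  refine Set.Finite.of_injOn (f := fun f : OEdge G => (f.edge, f.side))
    (t := G.incidenceSet x ×ˢ (Set.univ : Set Bool)) ?_ ?_ ((hf x).prod Set.finite_univ)
  · intro f hx
    have hx' : f.tail = x := hx
    exact ⟨⟨_, hx' ▸ f.isLink⟩, trivial⟩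
  · intro f hx g hy h
    have hx' : f.tail = x := hx
    have hy' : g.tail = x := hy
    exact OEdge.eq_of_tail_edge_side (hx'.trans hy'.symm) (congrArg Prod.fst h)
      (congrArg Prod.snd h)

theorem nextSet_finite (hf : LocallyFinite G) (e : OEdge G) : (nextSet e).Finite :=
  (outSet_finite hf e.head).subset fun _ h => h.1

/-- `e(x,y)` is the number of oriented edges from `x` to `y`. -/
theorem edgeCount_eq_ncard (x y : V(G)) :
    edgeCount G x y = {f : OEdge G | f.tail = x ∧ f.head = y}.ncard := by
  unfold edgeCount
  split_ifs with h
  · subst h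
    have : {f : OEdge G | f.tail = x ∧ f.head = x}.ncard
        = ({e : β | G.IsLoopAt e x} ×ˢ (Set.univ : Set Bool)).ncard := by
      refine Set.ncard_congr (fun f _ => (f.edge, f.side)) ?_ ?_ ?_
      · rintro f ⟨h1, h2⟩
        have h3 := f.isLink
        rw [h1, h2] at h3
        exact ⟨h3, trivial⟩
      · intro f g h1 h2 h3
        exact OEdge.eq_of_tail_edge_side (h1.1.trans h2.1.symm) (congrArg Prod.fst h3)
          (congrArg Prod.snd h3)
      · rintro ⟨e, b⟩ ⟨h1, -⟩
        exact ⟨OEdge.loop e x h1 b, ⟨rfl, rfl⟩, rfl⟩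
    rw [this, Set.ncard_prod, Set.ncard_univ]
    simp [mul_comm]
  · symm
    refine Set.ncard_congr (fun f _ => f.edge) ?_ ?_ ?_
    · rintro f ⟨h1, h2⟩
      have h3 := f.isLink
      rwa [h1, h2] at h3
    · intro f g h1 h2 h3
      refine OEdge.eq_of_tail_edge_side (h1.1.trans h2.1.symm) h3 ?_
      obtain ⟨h1, h1'⟩ := h1
      obtain ⟨h2, h2'⟩ := h2
      cases f <;> cases g <;> simp_all [OEdge.tail, OEdge.head, OEdge.side]
    · intro e he
      exact ⟨OEdge.arc e x y h he, ⟨rfl, rfl⟩, rfl⟩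

/-- The degree is the number of oriented edges that start at the vertex. -/
theorem deg_eq_ncard (hf : LocallyFinite G) (x : V(G)) : deg G x = (outSet G x).ncard := by
  classical
  have hfin := outSet_finite hf x
  rw [Set.ncard_eq_toFinset_card _ hfin, deg,
    Finset.card_eq_sum_card_image OEdge.head hfin.toFinset]
  have hcount : ∀ y, edgeCount G x y = (hfin.toFinset.filter fun f => f.head = y).card := by
    intro y
    rw [edgeCount_eq_ncard, ← Set.ncard_coe_finset]
    congr 1
    ext f
    simp [outSet]
  rw [finsum_eq_sum_of_support_subset (s := hfin.toFinset.image OEdge.head)]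
  · exact Finset.sum_congr rfl fun y _ => hcount y
  · intro y hy
    rw [Function.mem_support, hcount, Finset.card_ne_zero] at hy
    obtain ⟨f, hy⟩ := hy
    rw [Finset.mem_filter] at hy
    exact Finset.mem_coe.2 (Finset.mem_image.2 ⟨f, hy⟩)

theorem outSet_nonempty (hf : LocallyFinite G) (h2 : MinDegreeAtLeast G 2) (x : V(G)) :
    (outSet G x).Nonempty := by
  refine Set.nonempty_of_ncard_ne_zero ?_
  have := h2 x
  rw [deg_eq_ncard hf] at this
  omega

theorem nextSet_nonempty (hf : LocallyFinite G) (h2 : MinDegreeAtLeast G 2) (e : OEdge G) :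
    (nextSet e).Nonempty := by
  have := h2 e.head
  rw [deg_eq_ncard hf] at this
  obtain ⟨f, hfo, hne⟩ := Set.exists_ne_of_one_lt_ncard (s := outSet G e.head) (by omega) e.rev
  exact ⟨f, hfo, hne⟩

end Finiteness

section Walk

variable {α β : Type*} {G : Graph α β} (hf : LocallyFinite G) (h2 : MinDegreeAtLeast G 2)

/-- The first oriented edge: uniform among the oriented edges that start at `x`. -/
def firstEdge (x : V(G)) : PMF (OEdge G) :=
  PMF.uniformOfFinset (outSet_finite hf x).toFinset
    ((Set.Finite.toFinset_nonempty _).2 (outSet_nonempty hf h2 x))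

/-- One step: after traversing `e`, the next oriented edge is uniform among those that start at
the end of `e` and are not the reversal of `e`. -/
def nextEdge (e : OEdge G) : PMF (OEdge G) :=
  PMF.uniformOfFinset (nextSet_finite hf e).toFinset
    ((Set.Finite.toFinset_nonempty _).2 (nextSet_nonempty hf h2 e))

/-- The law of the oriented edge traversed in step `n + 1` by the walk that starts at `x`. -/
def edgeLaw (x : V(G)) : ℕ → PMF (OEdge G)
  | 0 => firstEdge hf h2 x
  | n + 1 => (edgeLaw x n).bind (nextEdge hf h2)

/-- The law of the position after `n` steps of the walk that starts at `x`. -/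
def positionLaw (x : V(G)) : ℕ → PMF V(G)
  | 0 => PMF.pure x
  | n + 1 => (edgeLaw hf h2 x n).map OEdge.head

/-- `q^{(n)}(x,y)`: the probability that the non-backtracking random walk that starts at `x`
is at `y` after `n` steps. -/
def q (n : ℕ) (x y : V(G)) : ℝ := (positionLaw hf h2 x n y).toReal

end Walk

end NBRW

end

/-!
Averaging a function on the oriented edges over the successors `f` of an edge `e`, written `e → f`,
defines the transition operator `T` of the walk. Reversing edges turns `e → f` into
`f.rev → e.rev` and keeps the transition probability, so the transition matrix is doubly stochastic
(`tsum_nextEdge_left`). Hence `T` is a contraction of the Hilbert space `ℓ²` of the oriented edges,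
and the law of the edge traversed by the walk evolves by the adjoint of `T` (`lawL2_succ`). If `T`
preserves the norm of `u`, then `u` is constant on the successors of each edge
(`eq_avgL2_of_norm_eq`), so that all limits come down to the study of such `u`.

For Cesàro means on a finite graph, the mean ergodic theorem gives a limit `h` with `h e = h f`
whenever `e → f`. The walk on the edges need not be irreducible (the graph may be a cycle), but
connectedness still forces `h e + h e.rev` to be constant (`add_rev_eq_of_forall_nextSet_eq`), and
this determines the sum of `h` over the edges that end at a vertex.

For convergence without averaging, a Hilbert space argument (`tendsto_inner_pow_of_isometric`)
reduces `⟪a, T ^ n v⟫ → 0` for all `v` to the vectors `u` with `‖T ^ k u‖ = ‖u‖` for all `k`. On a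
finite graph of minimum degree three such a `u` depends on the initial vertex only, and is the sum
of a constant and a function that changes sign along every edge (`exists_eq_add_of_norm_eq`); the
second summand can be nonzero only for bipartite graphs. On an infinite graph `T ^ n u e = u f` for
every `f` that is `n` steps away from `e`. The edges that the walk can reach from `e` are infinitely
many: a finite set that cannot be left cannot be entered, and by the constancy of `h e + h e.rev`
for its indicator function `h`, it would contain one orientation of each edge. So `f` can be chosen
to escape to infinity, and `u f → 0` as `u` is square summable (`tendsto_avgL2_pow_apply_zero`).
-/

open Filter Topology NBRW

namespace NBRW

/-! ### Contractions of a Hilbert space -/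

section Hilbert

variable {H : Type*} [NormedAddCommGroup H] [InnerProductSpace ℝ H]

open scoped InnerProductSpace

theorem norm_apply_le_of_norm_le_one {T : H →L[ℝ] H} (hT : ‖T‖ ≤ 1) (v : H) : ‖T v‖ ≤ ‖v‖ := by
  simpa using T.le_of_opNorm_le hT v

theorem norm_pow_apply_le_of_norm_le_one {T : H →L[ℝ] H} (hT : ‖T‖ ≤ 1) (k : ℕ) (v : H) :
    ‖(T ^ k) v‖ ≤ ‖v‖ := by
  induction k with
  | zero => simp
  | succ k ih =>
    rw [pow_succ']
    exact (norm_apply_le_of_norm_le_one hT _).trans ih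

variable [CompleteSpace H]

open ContinuousLinearMap in
theorem inner_adjoint_pow (T : H →L[ℝ] H) (k : ℕ) (u v : H) :
    ⟪((adjoint T) ^ k) u, v⟫_ℝ = ⟪u, (T ^ k) v⟫_ℝ := by
  rw [← adjoint_inner_left, ← star_eq_adjoint, ← star_eq_adjoint, star_pow]

theorem norm_adjoint_le_one {T : H →L[ℝ] H} (hT : ‖T‖ ≤ 1) :
    ‖ContinuousLinearMap.adjoint T‖ ≤ 1 := by
  rwa [LinearIsometryEquiv.norm_map]

open ContinuousLinearMap in
/-- For a contraction `T`, the vector `T† T v` is close to `v` as soon as `T` almost preserves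
the norm of `v`. Stated for powers. -/
theorem norm_adjoint_pow_pow_sub_sq_le {T : H →L[ℝ] H} (hT : ‖T‖ ≤ 1) (k : ℕ) (v : H) :
    ‖((adjoint T) ^ k) ((T ^ k) v) - v‖ ^ 2 ≤ ‖v‖ ^ 2 - ‖(T ^ k) v‖ ^ 2 := by
  have h1 : ‖((adjoint T) ^ k) ((T ^ k) v)‖ ^ 2 ≤ ‖(T ^ k) v‖ ^ 2 :=
    pow_le_pow_left₀ (norm_nonneg _)
      (norm_pow_apply_le_of_norm_le_one (norm_adjoint_le_one hT) k _) 2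
  rw [norm_sub_sq_real, inner_adjoint_pow, real_inner_self_eq_norm_sq]
  linarith

open ContinuousLinearMap in
theorem adjoint_apply_apply_of_norm_eq {T : H →L[ℝ] H} (hT : ‖T‖ ≤ 1) {v : H}
    (hv : ‖T v‖ = ‖v‖) : adjoint T (T v) = v := by
  have h := norm_adjoint_pow_pow_sub_sq_le hT 1 v
  rw [pow_one, pow_one, hv, sub_self] at h
  have h0 : ‖adjoint T (T v) - v‖ = 0 := pow_eq_zero_iff two_ne_zero |>.1
    (le_antisymm h (sq_nonneg _))
  exact sub_eq_zero.1 (norm_eq_zero.1 h0)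

/-- Bounded families in a Hilbert space converge weakly along ultrafilters. -/
theorem exists_tendsto_inner_of_norm_le {ι : Type*} {b : ι → H} {C : ℝ} (hb : ∀ n, ‖b n‖ ≤ C)
    (𝒰 : Ultrafilter ι) :
    ∃ u : H, ∀ w, Tendsto (fun n => ⟪b n, w⟫_ℝ) 𝒰 (𝓝 ⟪u, w⟫_ℝ) := by
  let F : ι → WeakDual ℝ H := fun n => StrongDual.toWeakDual (InnerProductSpace.toDual ℝ H (b n))
  have hF : ∀ n, F n ∈ WeakDual.toStrongDual ⁻¹' Metric.closedBall (0 : StrongDual ℝ H) C := by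
    intro n
    change InnerProductSpace.toDual ℝ H (b n) ∈ Metric.closedBall 0 C
    rw [mem_closedBall_zero_iff, LinearIsometryEquiv.norm_map]
    exact hb n
  obtain ⟨x, -, hx⟩ := (WeakDual.isCompact_closedBall (𝕜 := ℝ) (E := H) 0
    C).ultrafilter_le_nhds (𝒰.map F) (by
      rw [le_principal_iff]
      exact Filter.mem_map.2 (Filter.univ_mem' hF))
  have hx' : Tendsto F 𝒰 (𝓝 x) := hx
  refine ⟨(InnerProductSpace.toDual ℝ H).symm (WeakDual.toStrongDual x), fun w => ?_⟩
  rw [InnerProductSpace.toDual_symm_apply]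
  have h1 : Tendsto (fun n => F n w) 𝒰 (𝓝 (x w)) :=
    ((WeakDual.eval_continuous (𝕜 := ℝ) w).tendsto x).comp hx'
  exact h1

open ContinuousLinearMap in
/-- A weak form of Foguel's theorem: to see that `⟪a, T ^ n v⟫` tends to `0` for every `v`, it
suffices to look at those `v` whose norm is preserved by all powers of the contraction `T`.
Every weak limit point of the vectors `(T†) ^ n a` is such a vector, because the norms of
`(T†) ^ n a` decrease to a limit. -/
theorem tendsto_inner_pow_of_isometric {T : H →L[ℝ] H} (hT : ‖T‖ ≤ 1) {a : H}
    (h : ∀ u : H, (∀ k : ℕ, ‖(T ^ k) u‖ = ‖u‖) →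
      Tendsto (fun n : ℕ => ⟪a, (T ^ n) u⟫_ℝ) atTop (𝓝 0)) (v : H) :
    Tendsto (fun n : ℕ => ⟪a, (T ^ n) v⟫_ℝ) atTop (𝓝 0) := by
  set S := adjoint T with hS
  have hS1 : ‖S‖ ≤ 1 := norm_adjoint_le_one hT
  have hST : adjoint S = T := adjoint_adjoint T
  let b : ℕ → H := fun n => (S ^ n) a
  have hb : ∀ k n, (S ^ k) (b n) = b (k + n) := fun k n => by
    simp only [b, pow_add]; rfl
  have hbT : ∀ n w, ⟪b n, w⟫_ℝ = ⟪a, (T ^ n) w⟫_ℝ := fun n w => inner_adjoint_pow T n a w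
  -- the norms of `b n` converge
  have hanti : Antitone fun n => ‖b n‖ ^ 2 := by
    refine antitone_nat_of_succ_le fun n => ?_
    have h1 := hb 1 n
    rw [pow_one, add_comm] at h1
    rw [← h1]
    exact pow_le_pow_left₀ (norm_nonneg _) (norm_apply_le_of_norm_le_one hS1 _) 2
  have hconv : Tendsto (fun n => ‖b n‖ ^ 2) atTop (𝓝 (⨅ n, ‖b n‖ ^ 2)) :=
    tendsto_atTop_ciInf hanti ⟨0, by rintro _ ⟨n, rfl⟩; positivity⟩
  -- hence `S ^ k (T ^ k (b n))` is asymptotically equal to `b n`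
  have hasymp : ∀ k : ℕ, Tendsto (fun n => ‖(S ^ k) ((T ^ k) (b n)) - b n‖) atTop (𝓝 0) := by
    intro k
    rw [← tendsto_add_atTop_iff_nat k]
    have hsq : Tendsto (fun n => √(‖b n‖ ^ 2 - ‖b (n + k)‖ ^ 2)) atTop (𝓝 0) := by
      have := (hconv.sub ((tendsto_add_atTop_iff_nat k).2 hconv)).sqrt
      simpa using this
    refine squeeze_zero (fun _ => norm_nonneg _) (fun n => ?_) hsq
    refine Real.le_sqrt_of_sq_le ?_
    have h1 := norm_adjoint_pow_pow_sub_sq_le hS1 k (b n)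
    rw [hST, hb, add_comm k n] at h1
    refine le_trans (pow_le_pow_left₀ (norm_nonneg _) ?_ 2) h1
    have h2 : (S ^ k) ((T ^ k) (b (n + k))) - b (n + k)
        = (S ^ k) ((T ^ k) (b (n + k)) - b n) := by
      rw [map_sub, hb, add_comm k n]
    rw [h2]
    exact norm_pow_apply_le_of_norm_le_one hS1 k _
  rw [tendsto_iff_ultrafilter]
  intro 𝒰 h𝒰
  -- the weak limit along an ultrafilter
  obtain ⟨u, hu⟩ := exists_tendsto_inner_of_norm_le (b := b) (C := ‖a‖)
    (fun n => norm_pow_apply_le_of_norm_le_one hS1 n a) 𝒰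
  have hfix : ∀ k w, ⟪u, (S ^ k) ((T ^ k) w)⟫_ℝ = ⟪u, w⟫_ℝ := by
    intro k w
    refine tendsto_nhds_unique (hu _) ?_
    have h1 : Tendsto (fun n => ⟪(S ^ k) ((T ^ k) (b n)) - b n, w⟫_ℝ) 𝒰 (𝓝 0) := by
      refine squeeze_zero_norm (fun n => norm_inner_le_norm _ _) ?_
      simpa using ((hasymp k).mono_left h𝒰).mul_const ‖w‖
    have h2 := (hu w).add h1
    rw [add_zero] at h2
    refine h2.congr fun n => ?_
    rw [inner_sub_left, add_sub_cancel, inner_adjoint_pow, real_inner_comm,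
      ← inner_adjoint_pow T, real_inner_comm]
  have hiso : ∀ k : ℕ, ‖(T ^ k) u‖ = ‖u‖ := by
    intro k
    have h1 := hfix k u
    rw [real_inner_comm, inner_adjoint_pow, real_inner_self_eq_norm_sq,
      real_inner_self_eq_norm_sq] at h1
    exact (pow_left_inj₀ (norm_nonneg _) (norm_nonneg _) two_ne_zero).1 h1
  have h0 : ⟪u, u⟫_ℝ = 0 :=
    tendsto_nhds_unique (hu u) (((h u hiso).mono_left h𝒰).congr fun n => (hbT n u).symm)
  rw [inner_self_eq_zero.1 h0] at hu
  simpa only [inner_zero_left] using (hu v).congr (hbT · v)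

/-- The mean ergodic theorem: the Cesàro means of the orbit of `a` under a contraction converge
to a fixed vector that has the same inner products as `a` with all fixed vectors. -/
theorem exists_fixed_tendsto_birkhoffAverage {T : H →L[ℝ] H} (hT : ‖T‖ ≤ 1) (a : H) :
    ∃ h : H, T h = h ∧ (∀ v, T v = v → ⟪h, v⟫_ℝ = ⟪a, v⟫_ℝ) ∧
      Tendsto (fun n => birkhoffAverage ℝ T id n a) atTop (𝓝 h) := by
  have hlim := T.tendsto_birkhoffAverage_orthogonalProjection hT a
  refine ⟨_, ?_, fun v hv => ?_, hlim⟩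
  · exact Subtype.property (p := fun v => v ∈ (T : H →ₗ[ℝ] H).eqLocus
      ((1 : H →L[ℝ] H) : H →ₗ[ℝ] H)) _
  · exact Submodule.inner_orthogonalProjectionOnto_eq_of_mem_right
      (⟨v, hv⟩ : (T : H →ₗ[ℝ] H).eqLocus ((1 : H →L[ℝ] H) : H →ₗ[ℝ] H)) a

end Hilbert

/-! ### Oriented edges, reversal and connectedness -/

section Edges

variable {α β : Type*} {G : Graph α β}

namespace OEdge

@[simp] theorem rev_rev (f : OEdge G) : f.rev.rev = f := by
  cases f <;> simp [rev]

@[simp] theorem tail_rev (f : OEdge G) : f.rev.tail = f.head := by cases f <;> rfl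

@[simp] theorem head_rev (f : OEdge G) : f.rev.head = f.tail := by cases f <;> rfl

/-- Reversal as a permutation of the oriented edges. -/
@[simps] def revEquiv (G : Graph α β) : OEdge G ≃ OEdge G where
  toFun := rev
  invFun := rev
  left_inv := rev_rev
  right_inv := rev_rev

theorem adj (f : OEdge G) : G.Adj f.tail f.head := ⟨f.edge, f.isLink⟩

end OEdge

theorem exists_oEdge_of_adj {x y : V(G)} (h : G.Adj x y) :
    ∃ f : OEdge G, f.tail = x ∧ f.head = y := by
  obtain ⟨e, he⟩ := h
  by_cases hxy : x = y
  · subst hxy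
    exact ⟨.loop e x he true, rfl, rfl⟩
  · exact ⟨.arc e x y hxy he, rfl, rfl⟩

theorem eq_of_forall_oEdge_eq (hc : Connected G) {γ : Type*} {F : V(G) → γ}
    (hF : ∀ f : OEdge G, F f.tail = F f.head) (x y : V(G)) : F x = F y := by
  obtain ⟨p⟩ := hc.preconnected x y
  induction p with
  | nil => rfl
  | cons h _ ih =>
    obtain ⟨f, rfl, rfl⟩ := exists_oEdge_of_adj h.2
    exact (hF f).trans ih

theorem mem_nextSet {e f : OEdge G} : f ∈ nextSet e ↔ f.tail = e.head ∧ f ≠ e.rev := Iff.rfl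

theorem rev_mem_nextSet_rev {e f : OEdge G} : e.rev ∈ nextSet f.rev ↔ f ∈ nextSet e := by
  simp only [mem_nextSet, OEdge.tail_rev, OEdge.head_rev, OEdge.rev_rev]
  constructor
  · rintro ⟨h1, h2⟩
    exact ⟨h1.symm, fun h => h2 h.symm⟩
  · rintro ⟨h1, h2⟩
    exact ⟨h1.symm, fun h => h2 h.symm⟩

theorem nextSet_ncard (hf : LocallyFinite G) (e : OEdge G) :
    (nextSet e).ncard = deg G e.head - 1 := by
  rw [deg_eq_ncard hf]
  have : nextSet e = outSet G e.head \ {e.rev} := rfl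
  rw [this, Set.ncard_sdiff_singleton_of_mem (by simp [outSet])]

/-- A function on the oriented edges that is unchanged along every step `e → f` of the
non-backtracking walk takes the same total value on the two orientations of every edge.
For two distinct oriented edges `e`, `f` with the same terminal vertex, `h e = h f.rev` and
`h f = h e.rev`, hence the two totals agree. -/
theorem add_rev_eq_of_forall_nextSet_eq (hf : LocallyFinite G) (hc : Connected G)
    (h2 : MinDegreeAtLeast G 2) {h : OEdge G → ℝ} (hh : ∀ e, ∀ f ∈ nextSet e, h e = h f)
    (e f : OEdge G) : h e + h e.rev = h f + h f.rev := by
  have key : ∀ e f : OEdge G, e.head = f.head → h e + h e.rev = h f + h f.rev := by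
    intro e f hef
    by_cases hne : e = f
    · rw [hne]
    · have h1 : f.rev ∈ nextSet e :=
        ⟨by simp [hef], fun h' => hne (OEdge.revEquiv G |>.injective h').symm⟩
      have h2 : e.rev ∈ nextSet f :=
        ⟨by simp [hef], fun h' => hne (OEdge.revEquiv G |>.injective h')⟩
      rw [hh e _ h1, hh f _ h2]
      ring
  choose out hout using fun x => outSet_nonempty hf h2 x
  have hout' : ∀ x, (out x).tail = x := hout
  have hhead : ∀ e : OEdge G, h e + h e.rev = h (out e.head) + h (out e.head).rev := by
    intro e
    rw [key e (out e.head).rev (by simp [hout']), OEdge.rev_rev, add_comm]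
  rw [hhead e, hhead f]
  refine eq_of_forall_oEdge_eq hc (F := fun x => h (out x) + h (out x).rev) (fun g => ?_) _ _
  rw [← hhead g, ← OEdge.head_rev, ← hhead g.rev, OEdge.rev_rev, add_comm]

end Edges

/-! ### The averaging operator of the non-backtracking walk -/

section Average

open scoped ENNReal InnerProductSpace

variable {α β : Type*} {G : Graph α β} (hf : LocallyFinite G)

/-- The mean of a function on the oriented edges over the possible successors of `e`, that is,
the transition operator of the non-backtracking walk applied to the function. -/
noncomputable def avg (u : OEdge G → ℝ) (e : OEdge G) : ℝ :=
  (∑ f ∈ (nextSet_finite hf e).toFinset, u f) / (nextSet_finite hf e).toFinset.card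

variable (h2 : MinDegreeAtLeast G 2)

include h2 in
theorem card_next_pos (e : OEdge G) : 0 < (nextSet_finite hf e).toFinset.card :=
  Finset.card_pos.2 ((Set.Finite.toFinset_nonempty _).2 (nextSet_nonempty hf h2 e))

theorem card_next (e : OEdge G) : (nextSet_finite hf e).toFinset.card = deg G e.head - 1 := by
  rw [← nextSet_ncard hf, Set.ncard_eq_toFinset_card _ (nextSet_finite hf e)]

theorem card_out (x : V(G)) : (outSet_finite hf x).toFinset.card = deg G x := by
  rw [deg_eq_ncard hf, Set.ncard_eq_toFinset_card _ (outSet_finite hf x)]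

theorem nextEdge_apply_of_mem {e f : OEdge G} (h : f ∈ nextSet e) :
    nextEdge hf h2 e f = ((nextSet_finite hf e).toFinset.card : ℝ≥0∞)⁻¹ := by
  simp [nextEdge, PMF.uniformOfFinset_apply, h]

theorem nextEdge_apply_of_notMem {e f : OEdge G} (h : f ∉ nextSet e) :
    nextEdge hf h2 e f = 0 := by
  simp [nextEdge, PMF.uniformOfFinset_apply, h]

/-- The non-backtracking walk is reversed by reversing the oriented edges. -/
theorem nextEdge_eq_nextEdge_rev (e f : OEdge G) :
    nextEdge hf h2 e f = nextEdge hf h2 f.rev e.rev := by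
  by_cases h : f ∈ nextSet e
  · rw [nextEdge_apply_of_mem hf h2 h, nextEdge_apply_of_mem hf h2 (rev_mem_nextSet_rev.2 h),
      card_next hf, card_next hf, OEdge.head_rev, h.1]
  · rw [nextEdge_apply_of_notMem hf h2 h,
      nextEdge_apply_of_notMem hf h2 (mt rev_mem_nextSet_rev.1 h)]

/-- The transition matrix on the oriented edges is doubly stochastic. -/
theorem tsum_nextEdge_left (f : OEdge G) : ∑' e, nextEdge hf h2 e f = 1 := by
  simp_rw [nextEdge_eq_nextEdge_rev hf h2 _ f]
  rw [← (nextEdge hf h2 f.rev).tsum_coe]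
  exact (OEdge.revEquiv G).tsum_eq (fun e => nextEdge hf h2 f.rev e)

theorem ofReal_avg {φ : OEdge G → ℝ} (hφ : ∀ e, 0 ≤ φ e) (e : OEdge G) :
    ENNReal.ofReal (avg hf φ e) = ∑' f, nextEdge hf h2 e f * ENNReal.ofReal (φ f) := by
  have hpos := card_next_pos hf h2 e
  rw [tsum_eq_sum (s := (nextSet_finite hf e).toFinset), avg,
    ENNReal.ofReal_div_of_pos (by exact_mod_cast hpos), ENNReal.ofReal_sum_of_nonneg (by simp [hφ]),
    ENNReal.ofReal_natCast, ENNReal.div_eq_inv_mul, Finset.mul_sum]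
  · refine Finset.sum_congr rfl fun f hfe => ?_
    rw [nextEdge_apply_of_mem hf h2 (by simpa using hfe)]
  · intro f hfe
    rw [nextEdge_apply_of_notMem hf h2 (by simpa using hfe), zero_mul]

theorem avg_nonneg {φ : OEdge G → ℝ} (hφ : ∀ e, 0 ≤ φ e) (e : OEdge G) : 0 ≤ avg hf φ e :=
  div_nonneg (Finset.sum_nonneg fun f _ => hφ f) (Nat.cast_nonneg _)

include h2 in
/-- Averaging preserves the total mass, because the transition matrix is doubly stochastic. -/
theorem hasSum_avg {φ : OEdge G → ℝ} (hφ : ∀ e, 0 ≤ φ e) {s : ℝ} (hs : HasSum φ s) :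
    HasSum (avg hf φ) s := by
  have h1 : ∑' e, ENNReal.ofReal (avg hf φ e) = ENNReal.ofReal s := by
    simp_rw [ofReal_avg hf h2 hφ]
    rw [ENNReal.tsum_comm]
    simp_rw [ENNReal.tsum_mul_right, tsum_nextEdge_left hf h2, one_mul]
    rw [← ENNReal.ofReal_tsum_of_nonneg hφ hs.summable, hs.tsum_eq]
  have hsum : Summable (avg hf φ) := by
    have := ENNReal.summable_toReal (f := fun e => ENNReal.ofReal (avg hf φ e))
      (by rw [h1]; exact ENNReal.ofReal_ne_top)
    simpa only [ENNReal.toReal_ofReal (avg_nonneg hf hφ _)] using this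
  have h3 := congrArg ENNReal.toReal h1
  rw [← ENNReal.ofReal_tsum_of_nonneg (avg_nonneg hf hφ) hsum,
    ENNReal.toReal_ofReal (tsum_nonneg (avg_nonneg hf hφ)),
    ENNReal.toReal_ofReal (hs.nonneg hφ)] at h3
  exact h3 ▸ hsum.hasSum

include h2 in
theorem avg_sq_sub_sq (u : OEdge G → ℝ) (e : OEdge G) :
    avg hf (fun f => u f ^ 2) e - avg hf u e ^ 2 = avg hf (fun f => (u f - avg hf u e) ^ 2) e := by
  have hpos : (0 : ℝ) < (nextSet_finite hf e).toFinset.card := by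
    exact_mod_cast card_next_pos hf h2 e
  have hm : ∑ f ∈ (nextSet_finite hf e).toFinset, u f
      = avg hf u e * (nextSet_finite hf e).toFinset.card := by
    rw [avg, div_mul_cancel₀ _ hpos.ne']
  generalize avg hf u e = m at hm ⊢
  simp only [avg, sub_sq, Finset.sum_add_distrib, Finset.sum_sub_distrib, ← Finset.sum_mul,
    ← Finset.mul_sum, hm, Finset.sum_const, nsmul_eq_mul]
  field_simp
  ring

include h2 in
theorem sq_avg_le (u : OEdge G → ℝ) (e : OEdge G) :
    avg hf u e ^ 2 ≤ avg hf (fun f => u f ^ 2) e := by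
  have h := avg_nonneg hf (φ := fun f => (u f - avg hf u e) ^ 2) (fun f => sq_nonneg _) e
  rw [← avg_sq_sub_sq hf h2] at h
  linarith

include h2 in
theorem avg_eq_of_forall_eq {u : OEdge G → ℝ} {e : OEdge G} {c : ℝ}
    (h : ∀ f ∈ nextSet e, u f = c) : avg hf u e = c := by
  have hpos : (0 : ℝ) < (nextSet_finite hf e).toFinset.card := by
    exact_mod_cast card_next_pos hf h2 e
  rw [avg, Finset.sum_congr rfl fun f hfe => h f (by simpa using hfe), Finset.sum_const,
    nsmul_eq_mul, mul_div_cancel_left₀ _ hpos.ne']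

variable (G) in
/-- The Hilbert space of square summable real functions on the oriented edges. -/
abbrev EdgeL2 : Type _ := lp (fun _ : OEdge G => ℝ) 2

theorem memℓp_two_iff {ι : Type*} {u : ι → ℝ} :
    Memℓp u 2 ↔ Summable fun i => u i ^ 2 := by
  rw [memℓp_gen_iff (by simp)]
  simp

theorem EdgeL2.hasSum_sq (u : EdgeL2 G) : HasSum (fun e => u e ^ 2) (‖u‖ ^ 2) := by
  have := lp.hasSum_inner (𝕜 := ℝ) u u
  rw [real_inner_self_eq_norm_sq] at this
  simpa [sq] using this

include h2 in
theorem memℓp_avg (u : EdgeL2 G) : Memℓp (avg hf u) 2 := by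
  rw [memℓp_two_iff]
  exact (hasSum_avg hf h2 (fun e => sq_nonneg _) u.hasSum_sq).summable.of_nonneg_of_le
    (fun e => sq_nonneg _) (sq_avg_le hf h2 u)

include h2 in
theorem norm_le_of_forall_eq_avg {u w : EdgeL2 G} (hw : ∀ e, w e = avg hf u e) : ‖w‖ ≤ ‖u‖ := by
  rw [← pow_le_pow_iff_left₀ (norm_nonneg _) (norm_nonneg _) two_ne_zero]
  have h := hasSum_avg hf h2 (fun e => sq_nonneg (u e)) u.hasSum_sq
  refine hasSum_le (fun e => ?_) w.hasSum_sq h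
  rw [hw e]
  exact sq_avg_le hf h2 u e

theorem avg_add (u v : OEdge G → ℝ) : avg hf (u + v) = avg hf u + avg hf v := by
  ext e
  simp [avg, Finset.sum_add_distrib, add_div]

theorem avg_smul (c : ℝ) (u : OEdge G → ℝ) : avg hf (c • u) = c • avg hf u := by
  ext e
  simp [avg, ← Finset.mul_sum, mul_div_assoc]

/-- The averaging operator on square summable functions on the oriented edges. -/
noncomputable def avgL2 : EdgeL2 G →L[ℝ] EdgeL2 G :=
  LinearMap.mkContinuous
    { toFun := fun u => ⟨avg hf u, memℓp_avg hf h2 u⟩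
      map_add' := fun u v => Subtype.ext (avg_add hf u v)
      map_smul' := fun c u => Subtype.ext (avg_smul hf c u) } 1 fun _ =>
    (norm_le_of_forall_eq_avg hf h2 fun _ => rfl).trans_eq (one_mul _).symm

@[simp] theorem avgL2_apply (u : EdgeL2 G) (e : OEdge G) : avgL2 hf h2 u e = avg hf u e := rfl

theorem norm_avgL2_le : ‖avgL2 hf h2‖ ≤ 1 :=
  LinearMap.mkContinuous_norm_le _ zero_le_one _

/-- If averaging preserves the norm of `u`, then the variance of `u` over the successors of each
oriented edge vanishes. -/
theorem eq_avgL2_of_norm_eq {u : EdgeL2 G} (hu : ‖avgL2 hf h2 u‖ = ‖u‖) {e f : OEdge G}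
    (hef : f ∈ nextSet e) : u f = avgL2 hf h2 u e := by
  have h1 := (hasSum_avg hf h2 (fun e => sq_nonneg _) u.hasSum_sq).sub
    (avgL2 hf h2 u).hasSum_sq
  rw [hu, sub_self] at h1
  have h3 := (hasSum_zero_iff_of_nonneg fun e => sub_nonneg.2 (sq_avg_le hf h2 u e)).1 h1
  have h4 : avg hf (fun f => (u f - avg hf u e) ^ 2) e = 0 := by
    rw [← avg_sq_sub_sq hf h2]
    exact congrFun h3 e
  have hpos := (card_next_pos hf h2 e).ne'
  rw [avg, div_eq_zero_iff, or_iff_left (by exact_mod_cast hpos),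
    Finset.sum_eq_zero_iff_of_nonneg fun f _ => sq_nonneg _] at h4
  have h5 := h4 f (by simpa using hef)
  rw [sq_eq_zero_iff, sub_eq_zero] at h5
  exact h5

end Average

/-! ### The law of the walk in the Hilbert space -/

section Law

open scoped ENNReal InnerProductSpace

variable {α β : Type*} {G : Graph α β} (hf : LocallyFinite G) (h2 : MinDegreeAtLeast G 2)

theorem memℓp_two_toReal {ι : Type*} (p : PMF ι) : Memℓp (fun i => (p i).toReal) 2 := by
  rw [memℓp_two_iff]
  have h1 : Summable fun i => (p i).toReal := ENNReal.summable_toReal p.tsum_coe_ne_top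
  refine h1.of_nonneg_of_le (fun i => sq_nonneg _) fun i => ?_
  have h0 : (p i).toReal ≤ 1 := by
    simpa using ENNReal.toReal_mono ENNReal.one_ne_top (p.coe_le_one i)
  nlinarith [ENNReal.toReal_nonneg (a := p i)]

/-- The law of the oriented edge traversed in step `n + 1`, as a square summable function. -/
noncomputable def lawL2 (x : V(G)) (n : ℕ) : EdgeL2 G :=
  ⟨fun e => (edgeLaw hf h2 x n e).toReal, memℓp_two_toReal _⟩

theorem lawL2_apply (x : V(G)) (n : ℕ) (e : OEdge G) :
    lawL2 hf h2 x n e = (edgeLaw hf h2 x n e).toReal := rfl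

open Classical in
/-- The indicator function of one oriented edge. -/
noncomputable def edgeIndicator (f : OEdge G) : EdgeL2 G := lp.single 2 f 1

theorem inner_edgeIndicator (u : EdgeL2 G) (f : OEdge G) : ⟪u, edgeIndicator f⟫_ℝ = u f := by
  simp [edgeIndicator, lp.inner_single_right]

theorem avgL2_edgeIndicator (e f : OEdge G) :
    avgL2 hf h2 (edgeIndicator f) e = (nextEdge hf h2 e f).toReal := by
  classical
  rw [avgL2_apply, avg]
  by_cases h : f ∈ nextSet e
  · rw [nextEdge_apply_of_mem hf h2 h, Finset.sum_eq_single f]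
    · simp [edgeIndicator]
    · intro g _ hg
      simp [edgeIndicator, hg]
    · intro h'
      simp [h] at h'
  · rw [nextEdge_apply_of_notMem hf h2 h, Finset.sum_eq_zero]
    · simp
    · intro g hg
      have : g ≠ f := by rintro rfl; exact h (by simpa using hg)
      simp [edgeIndicator, this]

theorem lawL2_succ (x : V(G)) (n : ℕ) :
    lawL2 hf h2 x (n + 1) = ContinuousLinearMap.adjoint (avgL2 hf h2) (lawL2 hf h2 x n) := by
  ext f
  rw [← inner_edgeIndicator (ContinuousLinearMap.adjoint _ _),
    ContinuousLinearMap.adjoint_inner_left, lp.inner_eq_tsum, lawL2_apply, edgeLaw,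
    PMF.bind_apply, ENNReal.tsum_toReal_eq fun e =>
      ENNReal.mul_ne_top (PMF.apply_ne_top _ _) (PMF.apply_ne_top _ _)]
  refine tsum_congr fun e => ?_
  rw [avgL2_edgeIndicator, lawL2_apply, ENNReal.toReal_mul]
  simp [mul_comm]

theorem lawL2_eq_pow (x : V(G)) (n : ℕ) :
    lawL2 hf h2 x n = ((ContinuousLinearMap.adjoint (avgL2 hf h2)) ^ n) (lawL2 hf h2 x 0) := by
  induction n with
  | zero => rfl
  | succ n ih => rw [lawL2_succ, ih, pow_succ']; rfl

theorem inner_lawL2 (x : V(G)) (n : ℕ) (u : EdgeL2 G) :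
    ⟪lawL2 hf h2 x n, u⟫_ℝ = ⟪lawL2 hf h2 x 0, (avgL2 hf h2 ^ n) u⟫_ℝ := by
  rw [lawL2_eq_pow, inner_adjoint_pow]

theorem lawL2_zero_apply_of_mem {x : V(G)} {e : OEdge G} (he : e.tail = x) :
    lawL2 hf h2 x 0 e = ((deg G x : ℝ))⁻¹ := by
  have he' : e ∈ outSet G x := he
  rw [lawL2_apply, edgeLaw, firstEdge, PMF.uniformOfFinset_apply, if_pos (by simpa using he'),
    ENNReal.toReal_inv, ENNReal.toReal_natCast, card_out hf]

theorem lawL2_zero_apply_of_notMem {x : V(G)} {e : OEdge G} (he : e.tail ≠ x) :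
    lawL2 hf h2 x 0 e = 0 := by
  have he' : e ∉ outSet G x := he
  rw [lawL2_apply, edgeLaw, firstEdge, PMF.uniformOfFinset_apply, if_neg (by simpa using he')]
  rfl

theorem inner_lawL2_zero (x : V(G)) (u : EdgeL2 G) :
    ⟪lawL2 hf h2 x 0, u⟫_ℝ = ∑ e ∈ (outSet_finite hf x).toFinset, (deg G x : ℝ)⁻¹ * u e := by
  rw [lp.inner_eq_tsum, tsum_eq_sum (s := (outSet_finite hf x).toFinset)]
  · refine Finset.sum_congr rfl fun e he => ?_
    have he' : e ∈ outSet G x := by simpa using he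
    rw [lawL2_zero_apply_of_mem hf h2 he']
    simp [mul_comm]
  · intro e he
    rw [lawL2_zero_apply_of_notMem hf h2 fun h => he ((Set.Finite.mem_toFinset _).2 h)]
    simp

theorem inSet_finite (hf : LocallyFinite G) (y : V(G)) : {f : OEdge G | f.head = y}.Finite := by
  refine ((outSet_finite hf y).image OEdge.rev).subset fun f hy => ⟨f.rev, ?_, f.rev_rev⟩
  simpa [outSet] using hy

theorem card_inSet (y : V(G)) : (inSet_finite hf y).toFinset.card = deg G y := by
  rw [deg_eq_ncard hf, ← Set.ncard_eq_toFinset_card _ (inSet_finite hf y)]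
  refine Set.ncard_congr (fun f _ => f.rev) (fun f hy => ?_)
    (fun f g _ _ h => (OEdge.revEquiv G).injective h) fun f hy => ⟨f.rev, ?_, f.rev_rev⟩
  · simpa [outSet] using hy
  · simpa [outSet] using hy

theorem q_succ (n : ℕ) (x y : V(G)) :
    q hf h2 (n + 1) x y = ∑ f ∈ (inSet_finite hf y).toFinset, lawL2 hf h2 x n f := by
  rw [q, positionLaw, PMF.map_apply, tsum_eq_sum (s := (inSet_finite hf y).toFinset),
    ENNReal.toReal_sum]
  · refine Finset.sum_congr rfl fun f hy => ?_
    have : y = f.head := by simpa [eq_comm] using hy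
    rw [if_pos this, lawL2_apply]
  · intro f _
    split_ifs
    · exact PMF.apply_ne_top _ _
    · exact ENNReal.zero_ne_top
  · intro f hy
    have : ¬ y = f.head := by simpa [eq_comm] using hy
    rw [if_neg this]

end Law

/-! ### Infinite graphs -/

section Limits

open scoped InnerProductSpace

variable {α β : Type*} {G : Graph α β}

/-- The oriented edges that the non-backtracking walk can traverse `n` steps after `e`. -/
def reachSet (e : OEdge G) : ℕ → Set (OEdge G)
  | 0 => {e}
  | n + 1 => ⋃ f ∈ reachSet e n, nextSet f

theorem mem_reachSet_succ {e f : OEdge G} {n : ℕ} :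
    f ∈ reachSet e (n + 1) ↔ ∃ g ∈ reachSet e n, f ∈ nextSet g := by
  simp [reachSet]

theorem reachSet_finite (hf : LocallyFinite G) (e : OEdge G) (n : ℕ) :
    (reachSet e n).Finite := by
  induction n with
  | zero => exact Set.finite_singleton e
  | succ n ih => exact ih.biUnion fun f _ => nextSet_finite hf f

variable (hf : LocallyFinite G) (h2 : MinDegreeAtLeast G 2)

theorem avgL2_isometric {u : EdgeL2 G} (hu : ∀ k : ℕ, ‖(avgL2 hf h2 ^ k) u‖ = ‖u‖) (k : ℕ) :
    ‖(avgL2 hf h2 ^ k) (avgL2 hf h2 u)‖ = ‖avgL2 hf h2 u‖ := by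
  have h1 := hu (k + 1)
  have h3 := hu 1
  rw [pow_succ] at h1
  rw [pow_one] at h3
  exact h1.trans h3.symm

/-- If all iterates of averaging preserve the norm of `u`, then averaging merely transports the
values of `u` along the steps of the walk. -/
theorem avgL2_pow_apply_of_mem_reachSet {u : EdgeL2 G}
    (hu : ∀ k : ℕ, ‖(avgL2 hf h2 ^ k) u‖ = ‖u‖) {e f : OEdge G} {n : ℕ}
    (hef : f ∈ reachSet e n) : (avgL2 hf h2 ^ n) u e = u f := by
  induction n generalizing u f with
  | zero =>
    obtain rfl : f = e := hef
    rfl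
  | succ n ih =>
    obtain ⟨g, hg, hgf⟩ := mem_reachSet_succ.1 hef
    rw [eq_avgL2_of_norm_eq hf h2 (by simpa using hu 1) hgf, ← ih (avgL2_isometric hf h2 hu) hg,
      pow_succ]
    rfl

include hf h2 in
/-- A finite set of oriented edges that the walk cannot leave cannot be entered either, because
the counting measure is invariant. -/
theorem mem_of_mem_nextSet_of_closed {R : Set (OEdge G)} (hR : R.Finite)
    (hcl : ∀ e ∈ R, nextSet e ⊆ R) {e f : OEdge G} (hef : f ∈ nextSet e) (hfR : f ∈ R) :
    e ∈ R := by
  classical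
  by_contra he
  let φ : OEdge G → ℝ := R.indicator 1
  have hφ0 : ∀ e, 0 ≤ φ e := fun e => Set.indicator_nonneg (by simp) e
  have hφs : HasSum φ (∑ e ∈ hR.toFinset, φ e) :=
    hasSum_sum_of_ne_finset_zero fun e he => Set.indicator_of_notMem (by simpa using he) _
  have hle : ∀ e, φ e ≤ avg hf φ e := by
    intro e
    by_cases he : e ∈ R
    · rw [avg_eq_of_forall_eq hf h2 (c := 1)
        fun f hf' => Set.indicator_of_mem (hcl e he hf') _]
      simp [φ, he]
    · simpa [φ, he] using avg_nonneg hf hφ0 e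
  have h0 := (hasSum_avg hf h2 hφ0 hφs).sub hφs
  rw [sub_self, hasSum_zero_iff_of_nonneg fun e => sub_nonneg.2 (hle e)] at h0
  have h1 : avg hf φ e = 0 := by
    have := congrFun h0 e
    simpa [φ, he] using this
  rw [avg, div_eq_zero_iff, or_iff_left (by exact_mod_cast (card_next_pos hf h2 e).ne'),
    Finset.sum_eq_zero_iff_of_nonneg fun f _ => hφ0 f] at h1
  simpa [φ, hfR] using h1 f (by simpa using hef)

include hf h2 in
theorem finite_oEdge_of_closed (hc : Connected G) {R : Set (OEdge G)} (hR : R.Finite)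
    (hne : R.Nonempty) (hcl : ∀ e ∈ R, nextSet e ⊆ R) : Finite (OEdge G) := by
  classical
  have hconst := add_rev_eq_of_forall_nextSet_eq hf hc h2 (h := R.indicator 1) fun e f hef => by
    by_cases he : e ∈ R
    · rw [Set.indicator_of_mem he, Set.indicator_of_mem (hcl e he hef)]; rfl
    · rw [Set.indicator_of_notMem he, Set.indicator_of_notMem
        fun h => he (mem_of_mem_nextSet_of_closed hf h2 hR hcl hef h)]
  refine Set.finite_univ_iff.1 ((hR.union (hR.image OEdge.rev)).subset fun e _ => ?_)
  by_contra he
  rw [Set.mem_union, not_or] at he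
  have he2 : e.rev ∉ R := fun h => he.2 ⟨_, h, e.rev_rev⟩
  obtain ⟨g, hg⟩ := hne
  have h1 := hconst g e
  rw [Set.indicator_of_mem hg, Set.indicator_of_notMem he.1, Set.indicator_of_notMem he2] at h1
  have h3 : (0 : ℝ) ≤ R.indicator 1 g.rev := Set.indicator_nonneg (by simp) _
  simp only [Pi.one_apply] at h1
  linarith

include hf h2 in
/-- In an infinite graph, for every `n` some oriented edge can be reached from `e` in `n` steps
but not in fewer. -/
theorem exists_mem_reachSet_forall_notMem (hc : Connected G) [Infinite (OEdge G)] (e : OEdge G)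
    (n : ℕ) : ∃ f ∈ reachSet e n, ∀ m < n, f ∉ reachSet e m := by
  by_contra! hcon
  refine not_finite_iff_infinite.2 ‹Infinite (OEdge G)› (finite_oEdge_of_closed hf h2 hc
    (R := ⋃ m ∈ Set.Iio n, reachSet e m)
    ((Set.finite_Iio n).biUnion fun m _ => reachSet_finite hf e m) ?_ ?_)
  · have hn : 0 < n := by
      by_contra hn
      obtain rfl : n = 0 := by omega
      obtain ⟨m, hm, -⟩ := hcon e rfl
      exact Nat.not_lt_zero m hm
    exact ⟨e, Set.mem_biUnion (Set.mem_Iio.2 hn) rfl⟩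
  · intro g hg f hgf
    simp only [Set.mem_iUnion, Set.mem_Iio, exists_prop] at hg ⊢
    obtain ⟨m, hm, hgm⟩ := hg
    have hfm : f ∈ reachSet e (m + 1) := mem_reachSet_succ.2 ⟨g, hgm, hgf⟩
    rcases Nat.lt_or_ge (m + 1) n with h | h
    · exact ⟨m + 1, h, hfm⟩
    · obtain rfl : m + 1 = n := by omega
      exact hcon f hfm

/-- On an infinite graph, averaging transports the values of a norm preserved function along
edges that escape to infinity, where a square summable function is small. -/
theorem tendsto_avgL2_pow_apply_zero (hc : Connected G) [Infinite (OEdge G)] {u : EdgeL2 G}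
    (hu : ∀ k : ℕ, ‖(avgL2 hf h2 ^ k) u‖ = ‖u‖) (e : OEdge G) :
    Tendsto (fun n : ℕ => (avgL2 hf h2 ^ n) u e) atTop (𝓝 0) := by
  choose f hfr hfn using exists_mem_reachSet_forall_notMem hf h2 hc e
  have hinj : Function.Injective f := by
    intro m n hmn
    rcases lt_trichotomy m n with h | h | h
    · exact absurd (hmn ▸ hfr m) (hfn n m h)
    · exact h
    · exact absurd (hmn ▸ hfr n) (hfn m n h)
  have h0 : Tendsto (fun e => u e) cofinite (𝓝 0) := by
    have := (u.hasSum_sq.summable.tendsto_cofinite_zero).sqrt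
    simp only [Real.sqrt_sq_eq_abs, Real.sqrt_zero] at this
    exact (tendsto_zero_iff_abs_tendsto_zero _).2 this
  have h1 := h0.comp hinj.tendsto_cofinite
  rw [Nat.cofinite_eq_atTop] at h1
  exact h1.congr fun n => (avgL2_pow_apply_of_mem_reachSet hf h2 hu (hfr n)).symm

theorem tendsto_q_of_infinite (hc : Connected G) (hV : V(G).Infinite) (x y : V(G)) :
    Tendsto (fun n : ℕ => q hf h2 n x y) atTop (𝓝 0) := by
  have : Infinite V(G) := hV.to_subtype
  have : Infinite (OEdge G) := Infinite.of_surjective OEdge.tail fun x => outSet_nonempty hf h2 x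
  rw [← tendsto_add_atTop_iff_nat 1]
  simp_rw [q_succ]
  rw [show (0 : ℝ) = ∑ f ∈ (inSet_finite hf y).toFinset, 0 by simp]
  refine tendsto_finsetSum _ fun f _ => ?_
  refine Tendsto.congr (fun n => ((inner_edgeIndicator _ f).symm.trans
    (inner_lawL2 hf h2 x n _)).symm) ?_
  refine tendsto_inner_pow_of_isometric (norm_avgL2_le hf h2) (fun u hu => ?_) _
  simp_rw [inner_lawL2_zero]
  rw [show (0 : ℝ) = ∑ e ∈ (outSet_finite hf x).toFinset, (deg G x : ℝ)⁻¹ * 0 by simp]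
  exact tendsto_finsetSum _ fun e _ =>
    (tendsto_avgL2_pow_apply_zero hf h2 hc hu e).const_mul _

/-! ### Finite graphs: Cesàro means -/

theorem finite_oEdge (hf : LocallyFinite G) (hV : V(G).Finite) : Finite (OEdge G) := by
  have : Finite V(G) := hV
  refine Set.finite_univ_iff.1 ((Set.finite_iUnion fun x => outSet_finite hf x).subset ?_)
  exact fun e _ => Set.mem_iUnion.2 ⟨e.tail, rfl⟩

/-- A function on the oriented edges of a finite graph, as an element of the Hilbert space. -/
def toEdgeL2 [Finite (OEdge G)] (u : OEdge G → ℝ) : EdgeL2 G := ⟨u, Memℓp.all u⟩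

@[simp] theorem toEdgeL2_apply [Finite (OEdge G)] (u : OEdge G → ℝ) (e : OEdge G) :
    toEdgeL2 u e = u e := rfl

theorem inner_toEdgeL2 [Fintype (OEdge G)] (u : EdgeL2 G) (v : OEdge G → ℝ) :
    ⟪u, toEdgeL2 v⟫_ℝ = ∑ e, u e * v e := by
  rw [lp.inner_eq_tsum, tsum_fintype]
  simp [mul_comm]

theorem inner_lawL2_zero_toEdgeL2 [Finite (OEdge G)] (x : V(G)) (F : V(G) → ℝ) :
    ⟪lawL2 hf h2 x 0, toEdgeL2 fun e => F e.tail⟫_ℝ = F x := by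
  have hd : (deg G x : ℝ) ≠ 0 := by
    have := h2 x
    positivity
  rw [inner_lawL2_zero, Finset.sum_congr rfl (g := fun _ => (deg G x : ℝ)⁻¹ * F x),
    Finset.sum_const, card_out hf, nsmul_eq_mul, mul_inv_cancel_left₀ hd]
  intro e he
  have : e.tail = x := by simpa [outSet] using he
  rw [toEdgeL2_apply, this]

theorem avgL2_one [Finite (OEdge G)] :
    avgL2 hf h2 (toEdgeL2 fun _ => 1) = toEdgeL2 fun _ => 1 := by
  ext e
  exact avg_eq_of_forall_eq hf h2 fun _ _ => rfl

include h2 in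
/-- For a function that is unchanged along every step of the walk, the sum over the oriented
edges that end at `y` equals the sum over those that start at `y`. -/
theorem sum_inSet_eq_sum_inSet_rev {h : OEdge G → ℝ} (hh : ∀ e, ∀ f ∈ nextSet e, h e = h f)
    (y : V(G)) : ∑ f ∈ (inSet_finite hf y).toFinset, h f
      = ∑ f ∈ (inSet_finite hf y).toFinset, h f.rev := by
  classical
  set A := (inSet_finite hf y).toFinset with hA
  have hcard : A.card = deg G y := card_inSet hf y
  have h1 : ∀ f ∈ A, ((A.card : ℝ) - 1) * h f = ∑ g ∈ A, h g.rev - h f.rev := by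
    intro f hfA
    rw [← Finset.sum_erase_eq_sub hfA, Finset.sum_congr rfl (g := fun _ => h f),
      Finset.sum_const, Finset.card_erase_of_mem hfA, nsmul_eq_mul, Nat.cast_sub, Nat.cast_one]
    · exact Finset.card_pos.2 ⟨f, hfA⟩
    · intro g hg
      rw [Finset.mem_erase] at hg
      have hgy : g.head = y := by simpa [hA] using hg.2
      have hfy : f.head = y := by simpa [hA] using hfA
      exact (hh f g.rev ⟨by simp [hgy, hfy],
        fun h' => hg.1 ((OEdge.revEquiv G).injective h')⟩).symm
  have h3 := Finset.sum_congr rfl h1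
  rw [← Finset.mul_sum, Finset.sum_sub_distrib, Finset.sum_const, nsmul_eq_mul] at h3
  have hpos : (1 : ℝ) < A.card := by
    rw [hcard]
    exact_mod_cast h2 y
  refine mul_left_cancel₀ (sub_ne_zero.2 hpos.ne') (h3.trans ?_)
  ring

theorem tendsto_cesaro_q (hc : Connected G) (hV : V(G).Finite) (x y : V(G)) :
    Tendsto (fun n : ℕ => (1 / (n : ℝ)) * ∑ k ∈ Finset.Icc 1 n, q hf h2 k x y) atTop
      (𝓝 ((deg G y : ℝ) / (Nat.card (OEdge G) : ℝ))) := by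
  have := finite_oEdge hf hV
  have := Fintype.ofFinite (OEdge G)
  set T := avgL2 hf h2 with hT
  set S := ContinuousLinearMap.adjoint T with hS
  have hT1 : ‖T‖ ≤ 1 := norm_avgL2_le hf h2
  have hS1 : ‖S‖ ≤ 1 := norm_adjoint_le_one hT1
  obtain ⟨h, hSh, hinner, hlim⟩ := exists_fixed_tendsto_birkhoffAverage hS1 (lawL2 hf h2 x 0)
  have hTh : T h = h := by
    have h1 := adjoint_apply_apply_of_norm_eq hS1 (v := h) (by rw [hSh])
    rwa [hSh, hS, ContinuousLinearMap.adjoint_adjoint] at h1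
  -- the limit is unchanged along every step of the walk
  have hstep : ∀ e, ∀ f ∈ nextSet e, h e = h f := by
    intro e f hef
    rw [eq_avgL2_of_norm_eq hf h2 (u := h) (by rw [← hT, hTh]) hef, ← hT, hTh]
  have hS_one : S (toEdgeL2 fun _ => 1) = toEdgeL2 fun _ => 1 := by
    have h1 := adjoint_apply_apply_of_norm_eq hT1 (v := toEdgeL2 fun _ => 1)
      (by rw [hT, avgL2_one])
    rwa [hT, avgL2_one] at h1
  have hmass : ∑ e, h e = 1 := by
    have h1 := hinner _ hS_one
    rw [inner_toEdgeL2, inner_lawL2_zero_toEdgeL2 hf h2 x fun _ => 1] at h1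
    simpa using h1
  have hE : (Nat.card (OEdge G) : ℝ) ≠ 0 := by
    obtain ⟨e, -⟩ := outSet_nonempty hf h2 x
    have : Nonempty (OEdge G) := ⟨e⟩
    exact_mod_cast Nat.card_pos.ne'
  have hmass_rev : ∑ e : OEdge G, h e.rev = 1 :=
    ((OEdge.revEquiv G).sum_comp fun f => h f).trans hmass
  have hpair : ∀ e, h e + h e.rev = 2 / Nat.card (OEdge G) := by
    intro e
    rw [eq_div_iff hE, mul_comm, Nat.card_eq_fintype_card, ← nsmul_eq_mul, ← Finset.card_univ,
      ← Finset.sum_const, Finset.sum_congr rfl fun f _ =>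
        add_rev_eq_of_forall_nextSet_eq hf hc h2 hstep e f, Finset.sum_add_distrib, hmass,
      hmass_rev]
    norm_num
  have hval : ∑ f ∈ (inSet_finite hf y).toFinset, h f
      = (deg G y : ℝ) / Nat.card (OEdge G) := by
    have h1 := sum_inSet_eq_sum_inSet_rev hf h2 hstep y
    have h3 : ∑ f ∈ (inSet_finite hf y).toFinset, (h f + h f.rev)
        = deg G y * (2 / Nat.card (OEdge G)) := by
      rw [Finset.sum_congr rfl fun f _ => hpair f, Finset.sum_const, card_inSet hf, nsmul_eq_mul]
    rw [Finset.sum_add_distrib, ← h1] at h3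
    linear_combination h3 / 2
  rw [← hval]
  have hcoord : Tendsto (fun n => ∑ f ∈ (inSet_finite hf y).toFinset,
      ⟪birkhoffAverage ℝ S id n (lawL2 hf h2 x 0), edgeIndicator f⟫_ℝ) atTop
      (𝓝 (∑ f ∈ (inSet_finite hf y).toFinset, ⟪h, edgeIndicator f⟫_ℝ)) :=
    tendsto_finsetSum _ fun f _ => hlim.inner tendsto_const_nhds
  simp only [inner_edgeIndicator h] at hcoord
  refine hcoord.congr fun n => ?_
  have hiter : ∀ k, S^[k] (lawL2 hf h2 x 0) = lawL2 hf h2 x k := by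
    intro k
    induction k with
    | zero => rfl
    | succ k ih => rw [Function.iterate_succ_apply', ih, lawL2_succ]
  simp only [birkhoffAverage, birkhoffSum, hiter, id, inner_smul_left, sum_inner,
    inner_edgeIndicator]
  have hshift : ∑ k ∈ Finset.Icc 1 n, q hf h2 k x y
      = ∑ k ∈ Finset.range n, ∑ f ∈ (inSet_finite hf y).toFinset, lawL2 hf h2 x k f := by
    rw [← Finset.sum_congr rfl fun k _ => q_succ hf h2 k x y, Finset.range_eq_Ico,
      Finset.sum_Ico_add' (fun k => q hf h2 k x y) 0 n 1]
    rfl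
  rw [hshift, ← Finset.mul_sum, Finset.sum_comm, one_div]
  simp

/-! ### Finite graphs of minimum degree three -/

/-- If all degrees are at least `3`, any two oriented edges that start at `x` are possible
successors of a common oriented edge, the reversal of a third one; so a function whose norm is
preserved depends on the initial vertex only. -/
theorem eq_of_tail_eq_of_norm_eq (h3 : MinDegreeAtLeast G 3) {u : EdgeL2 G}
    (hu : ‖avgL2 hf h2 u‖ = ‖u‖) {f g : OEdge G} (hfg : f.tail = g.tail) : u f = u g := by
  have hcard : ({f, g} : Set (OEdge G)).ncard < (outSet G f.tail).ncard := by
    have h1 := h3 f.tail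
    rw [deg_eq_ncard hf] at h1
    have h4 : ({f, g} : Set (OEdge G)).ncard ≤ 2 := by
      simpa using Set.ncard_insert_le f {g}
    omega
  obtain ⟨k, hk, hkfg⟩ := Set.exists_mem_notMem_of_ncard_lt_ncard hcard
  have hk' : k.tail = f.tail := hk
  simp only [Set.mem_insert_iff, Set.mem_singleton_iff, not_or] at hkfg
  rw [eq_avgL2_of_norm_eq hf h2 hu (e := k.rev) (f := f)
      ⟨by simp [hk'], by simpa [eq_comm] using hkfg.1⟩,
    eq_avgL2_of_norm_eq hf h2 hu (e := k.rev) (f := g)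
      ⟨by simp [hk', hfg], by simpa [eq_comm] using hkfg.2⟩]

/-- A norm preserved function on a finite graph of minimum degree `3` is a combination of a
constant and of a function of the initial vertex that changes sign along every edge: `U` and `V`
below are the values of `u` and of its average, and `U + V` is constant while `U - V` changes
sign. -/
theorem exists_eq_add_of_norm_eq (hc : Connected G) (h3 : MinDegreeAtLeast G 3) {u : EdgeL2 G}
    (hu : ∀ k : ℕ, ‖(avgL2 hf h2 ^ k) u‖ = ‖u‖) :
    ∃ (s : ℝ) (D : V(G) → ℝ), (∀ f : OEdge G, D f.head = -D f.tail) ∧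
      ∀ f, u f = s + D f.tail := by
  have hu0 : ‖avgL2 hf h2 u‖ = ‖u‖ := by simpa using hu 1
  have hu1 : ‖avgL2 hf h2 (avgL2 hf h2 u)‖ = ‖avgL2 hf h2 u‖ := by
    simpa using avgL2_isometric hf h2 hu 1
  choose out hout using fun x => outSet_nonempty hf h2 x
  have hout' : ∀ x, (out x).tail = x := hout
  let U : V(G) → ℝ := fun x => u (out x)
  let V : V(G) → ℝ := fun x => avgL2 hf h2 u (out x)
  have hU : ∀ f, u f = U f.tail := fun f =>
    eq_of_tail_eq_of_norm_eq hf h2 h3 hu0 (hout' _).symm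
  have hV : ∀ f, avgL2 hf h2 u f = V f.tail := fun f =>
    eq_of_tail_eq_of_norm_eq hf h2 h3 hu1 (hout' _).symm
  have hVU : ∀ f : OEdge G, V f.tail = U f.head := by
    intro f
    obtain ⟨g, hg⟩ := nextSet_nonempty hf h2 f
    rw [← hV, ← eq_avgL2_of_norm_eq hf h2 hu0 hg, hU, hg.1]
  have hUV : ∀ f : OEdge G, V f.head = U f.tail := fun f => by
    simpa using hVU f.rev
  obtain ⟨x₀⟩ := hc.nonempty
  have hsum : ∀ x, U x + V x = U x₀ + V x₀ := fun x =>
    eq_of_forall_oEdge_eq hc (F := fun x => U x + V x)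
      (fun f => by simp only [hVU, hUV, add_comm]) x x₀
  refine ⟨(U x₀ + V x₀) / 2, fun x => (U x - V x) / 2, fun f => ?_, fun f => ?_⟩
  · simp only [hVU, hUV]
    ring
  · rw [hU, ← hsum f.tail]
    ring

/-- Let `σ` span the functions on the vertices that change sign along every edge, with `σ = 0` or
`σ = ±1`. On a finite graph of minimum degree `3` the law of the walk is asymptotic to its
projection on the constants and on the function `σ` of the initial vertex. -/
theorem tendsto_lawL2_sub (hc : Connected G) [Finite (OEdge G)] (h3 : MinDegreeAtLeast G 3)
    {σ : V(G) → ℝ} (hσ : ∀ f : OEdge G, σ f.head = -σ f.tail)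
    (hsq : ∀ x y, σ x * (σ y * σ y) = σ x)
    (hspan : ∀ D : V(G) → ℝ, (∀ f : OEdge G, D f.head = -D f.tail) → ∃ d : ℝ, ∀ x, D x = d * σ x)
    (x : V(G)) (f : OEdge G) :
    Tendsto (fun n : ℕ => lawL2 hf h2 x n f
      - (1 + (-1) ^ n * σ x * σ f.tail) / Nat.card (OEdge G)) atTop (𝓝 0) := by
  have := Fintype.ofFinite (OEdge G)
  set T := avgL2 hf h2 with hT
  have hT1 : ‖T‖ ≤ 1 := norm_avgL2_le hf h2
  set one : EdgeL2 G := toEdgeL2 fun _ => 1 with hone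
  set sgn : EdgeL2 G := toEdgeL2 fun e => σ e.tail with hsgn
  have hTone : T one = one := avgL2_one hf h2
  have hTsgn : T sgn = -sgn := by
    ext e
    refine avg_eq_of_forall_eq hf h2 fun f hef => ?_
    rw [hsgn, toEdgeL2_apply, hef.1, hσ]
    rfl
  have hTnone : ∀ n : ℕ, (T ^ n) one = one := fun n => by
    induction n with
    | zero => rfl
    | succ n ih => rw [pow_succ', mul_apply_eq_comp, ih, hTone]
  have hTnsgn : ∀ n : ℕ, (T ^ n) sgn = (-1 : ℝ) ^ n • sgn := fun n => by
    induction n with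
    | zero => simp
    | succ n ih =>
      rw [pow_succ', mul_apply_eq_comp, ih, map_smul, hTsgn, smul_neg, pow_succ']
      simp
  -- constants and `sgn` are eigenvectors of the adjoint as well
  have hSone : ∀ n : ℕ, ∀ v, ⟪one, (T ^ n) v⟫_ℝ = ⟪one, v⟫_ℝ := fun n v => by
    induction n with
    | zero => rfl
    | succ n ih =>
      rw [pow_succ', mul_apply_eq_comp, ← ih, ← T.adjoint_inner_left]
      have h1 := adjoint_apply_apply_of_norm_eq hT1 (v := one) (by rw [hTone])
      rw [hTone] at h1
      rw [h1]
  have hSsgn : ∀ n : ℕ, ∀ v, ⟪sgn, (T ^ n) v⟫_ℝ = (-1) ^ n * ⟪sgn, v⟫_ℝ := fun n v => by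
    induction n with
    | zero => simp
    | succ n ih =>
      rw [pow_succ', mul_apply_eq_comp, ← T.adjoint_inner_left]
      have h1 := adjoint_apply_apply_of_norm_eq hT1 (v := sgn) (by rw [hTsgn, norm_neg])
      rw [hTsgn, map_neg, neg_eq_iff_eq_neg] at h1
      rw [h1, inner_neg_left, ih]
      ring
  have hE : (Nat.card (OEdge G) : ℝ) ≠ 0 := by
    have : Nonempty (OEdge G) := ⟨f⟩
    exact_mod_cast Nat.card_pos.ne'
  have hone_one : ⟪one, one⟫_ℝ = Nat.card (OEdge G) := by
    rw [hone, inner_toEdgeL2]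
    simp
  have hsgn_one : ⟪sgn, one⟫_ℝ = 0 := by
    have h1 : ∑ e : OEdge G, σ e.rev.tail = ∑ e : OEdge G, σ e.tail :=
      (OEdge.revEquiv G).sum_comp fun e => σ e.tail
    simp only [OEdge.tail_rev, hσ, Finset.sum_neg_distrib] at h1
    rw [hone, inner_toEdgeL2]
    simp only [hsgn, toEdgeL2_apply, mul_one]
    linarith
  have hsgn_sgn : σ x * ⟪sgn, sgn⟫_ℝ = σ x * Nat.card (OEdge G) := by
    have h1 : ⟪sgn, sgn⟫_ℝ = ∑ e : OEdge G, σ e.tail * σ e.tail := by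
      conv_lhs => rw [hsgn, inner_toEdgeL2]
      rfl
    rw [h1, Finset.mul_sum, Finset.sum_congr rfl fun e _ => hsq x e.tail]
    simp [mul_comm]
  set c : ℝ := (Nat.card (OEdge G) : ℝ)⁻¹ with hc'
  set a := lawL2 hf h2 x 0 with ha
  have ha_one : ⟪a, one⟫_ℝ = 1 := inner_lawL2_zero_toEdgeL2 hf h2 x fun _ => 1
  have ha_sgn : ⟪a, sgn⟫_ℝ = σ x := inner_lawL2_zero_toEdgeL2 hf h2 x σ
  set w := a - (c • one + (c * σ x) • sgn) with hw
  have hw_one : ⟪w, one⟫_ℝ = 0 := by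
    rw [hw, inner_sub_left, inner_add_left, real_inner_smul_left, real_inner_smul_left, ha_one,
      hone_one, hsgn_one, hc', inv_mul_cancel₀ hE]
    ring
  have hw_sgn : ⟪w, sgn⟫_ℝ = 0 := by
    rw [hw, inner_sub_left, inner_add_left, real_inner_smul_left, real_inner_smul_left, ha_sgn,
      real_inner_comm, hsgn_one, mul_assoc, hsgn_sgn, hc']
    field_simp
    ring
  have hlim : Tendsto (fun n : ℕ => ⟪w, (T ^ n) (edgeIndicator f)⟫_ℝ) atTop (𝓝 0) := by
    refine tendsto_inner_pow_of_isometric hT1 (fun u hu => ?_) _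
    obtain ⟨s, D, hD, hus⟩ := exists_eq_add_of_norm_eq hf h2 hc h3 hu
    obtain ⟨d, hd⟩ := hspan D hD
    have hu' : u = s • one + d • sgn := by
      ext e
      rw [hus, hd]
      change _ = s * 1 + d * σ e.tail
      ring
    have h0 : ∀ n : ℕ, ⟪w, (T ^ n) u⟫_ℝ = 0 := fun n => by
      rw [hu', map_add, map_smul, map_smul, hTnone, hTnsgn, inner_add_right,
        real_inner_smul_right, real_inner_smul_right, real_inner_smul_right, hw_one, hw_sgn]
      ring
    simp only [h0, tendsto_const_nhds]
  refine hlim.congr fun n => ?_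
  rw [hw, inner_sub_left, inner_add_left, real_inner_smul_left, real_inner_smul_left, hSone, hSsgn,
    ← inner_lawL2, inner_edgeIndicator, inner_edgeIndicator, inner_edgeIndicator]
  change _ - (c * 1 + c * σ x * ((-1) ^ n * σ f.tail)) = _
  rw [hc']
  ring

theorem tendsto_q_sub (hc : Connected G) [Finite (OEdge G)] (h3 : MinDegreeAtLeast G 3)
    {σ : V(G) → ℝ} (hσ : ∀ f : OEdge G, σ f.head = -σ f.tail)
    (hsq : ∀ x y, σ x * (σ y * σ y) = σ x)
    (hspan : ∀ D : V(G) → ℝ, (∀ f : OEdge G, D f.head = -D f.tail) → ∃ d : ℝ, ∀ x, D x = d * σ x)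
    (x y : V(G)) :
    Tendsto (fun n : ℕ => q hf h2 n x y
      - deg G y * (1 + (-1) ^ n * σ x * σ y) / Nat.card (OEdge G)) atTop (𝓝 0) := by
  rw [← tendsto_add_atTop_iff_nat 1]
  have h1 : Tendsto (fun n : ℕ => ∑ f ∈ (inSet_finite hf y).toFinset, (lawL2 hf h2 x n f
      - (1 + (-1) ^ n * σ x * σ f.tail) / Nat.card (OEdge G))) atTop
      (𝓝 (∑ f ∈ (inSet_finite hf y).toFinset, 0)) :=
    tendsto_finsetSum _ fun f _ => tendsto_lawL2_sub hf h2 hc h3 hσ hsq hspan x f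
  rw [Finset.sum_const_zero] at h1
  refine h1.congr fun n => ?_
  rw [Finset.sum_sub_distrib, ← q_succ, Finset.sum_congr rfl
    (g := fun _ => (1 + (-1) ^ (n + 1) * σ x * σ y) / (Nat.card (OEdge G) : ℝ)),
    Finset.sum_const, card_inSet hf, nsmul_eq_mul, mul_div_assoc]
  intro f hy
  have hy' : f.head = y := by simpa using hy
  rw [← hy', hσ]
  ring

theorem tendsto_q_of_not_bipartite (hc : Connected G) (hV : V(G).Finite)
    (h3 : MinDegreeAtLeast G 3) (hb : ¬ Bipartite G) (x y : V(G)) :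
    Tendsto (fun n : ℕ => q hf h2 n x y) atTop
      (𝓝 ((deg G y : ℝ) / (Nat.card (OEdge G) : ℝ))) := by
  have := finite_oEdge hf hV
  -- a function that changes sign along every edge vanishes, otherwise its sign is a colouring
  have h1 := tendsto_q_sub hf h2 hc h3 (σ := fun _ => 0) (by simp) (by simp) (fun D hD => by
    refine ⟨0, fun x => ?_⟩
    by_contra hx
    rw [zero_mul] at hx
    refine hb ⟨fun y => decide (0 < D y), fun y z hyz => ?_⟩
    obtain ⟨f, rfl, rfl⟩ := exists_oEdge_of_adj hyz
    have h2 : D f.tail ^ 2 = D x ^ 2 :=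
      eq_of_forall_oEdge_eq hc (F := fun x => D x ^ 2) (fun f => by simp [hD]) _ _
    have h3 : D f.tail ≠ 0 := fun h => hx (by simpa [h] using h2.symm)
    simp only [hD]
    rcases lt_or_gt_of_ne h3 with h | h
    · simp [h, h.le]
    · simp [h, h.le]) x y
  simp only [mul_zero, add_zero, mul_one] at h1
  simpa using h1.add_const ((deg G y : ℝ) / (Nat.card (OEdge G) : ℝ))

theorem apply_eq_neg_one_pow_dist_mul (hc : Connected G) {σ : V(G) → ℝ}
    (hσ : ∀ f : OEdge G, σ f.head = -σ f.tail) (x y : V(G)) :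
    σ y = (-1) ^ NBRW.dist G x y * σ x := by
  obtain ⟨p, hp⟩ := SimpleGraph.Connected.exists_walk_length_eq_dist hc x y
  rw [NBRW.dist, ← hp]
  clear hp
  induction p with
  | nil => simp
  | cons h p ih =>
    obtain ⟨f, rfl, rfl⟩ := exists_oEdge_of_adj h.2
    rw [ih, hσ, SimpleGraph.Walk.length_cons]
    ring

theorem tendsto_q_of_bipartite (hc : Connected G) (hV : V(G).Finite)
    (h3 : MinDegreeAtLeast G 3) (hb : Bipartite G) (x y : V(G)) :
    Tendsto (fun n : ℕ => q hf h2 (2 * n + NBRW.dist G x y % 2) x y) atTop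
      (𝓝 (2 * (deg G y : ℝ) / (Nat.card (OEdge G) : ℝ))) := by
  have := finite_oEdge hf hV
  obtain ⟨col, hcol⟩ := hb
  let σ : V(G) → ℝ := fun x => if col x then 1 else -1
  have hσ : ∀ f : OEdge G, σ f.head = -σ f.tail := by
    intro f
    have := hcol _ _ f.adj
    cases h1 : col f.tail <;> cases h4 : col f.head <;> simp_all [σ]
  have hsq : ∀ y, σ y * σ y = 1 := fun y => by
    cases h1 : col y <;> simp [σ, h1]
  have h1 := tendsto_q_sub hf h2 hc h3 (σ := σ) hσ (fun x y => by rw [hsq, mul_one])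
    (fun D hD => by
      refine ⟨D x * σ x, fun z => ?_⟩
      have h4 : D z * σ z = D x * σ x :=
        eq_of_forall_oEdge_eq hc (F := fun x => D x * σ x) (fun f => by simp [hD, hσ]) _ _
      rw [← h4, mul_assoc, hsq, mul_one]) x y
  have hsub : Tendsto (fun n : ℕ => 2 * n + NBRW.dist G x y % 2) atTop atTop :=
    tendsto_atTop_mono (fun n => by rw [id]; omega) tendsto_id
  have h4 := (h1.comp hsub).add_const (2 * (deg G y : ℝ) / (Nat.card (OEdge G) : ℝ))
  rw [zero_add] at h4
  refine h4.congr fun n => ?_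
  have hsign : (-1 : ℝ) ^ (2 * n + NBRW.dist G x y % 2) * σ x * σ y = 1 := by
    rw [apply_eq_neg_one_pow_dist_mul hc hσ x y, pow_add, pow_mul, neg_one_sq, one_pow, one_mul,
      ← neg_one_pow_eq_pow_mod_two]
    calc (-1 : ℝ) ^ NBRW.dist G x y * σ x * ((-1) ^ NBRW.dist G x y * σ x)
        = ((-1) ^ NBRW.dist G x y * (-1) ^ NBRW.dist G x y) * (σ x * σ x) := by ring
      _ = 1 := by rw [hsq, ← mul_pow]; simp
  simp only [Function.comp, hsign]
  ring

end Limits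

end NBRW

open Filter Topology NBRW

theorem theorem1p1 {α β : Type*} (G : Graph α β) (hf : LocallyFinite G) (hc : Connected G)
    (h2 : MinDegreeAtLeast G 2) :
    (V(G).Finite → ∀ x y : V(G),
      Tendsto (fun n : ℕ => (1 / (n : ℝ)) * ∑ k ∈ Finset.Icc 1 n, q hf h2 k x y) atTop
        (𝓝 ((deg G y : ℝ) / (Nat.card (OEdge G) : ℝ)))) ∧
    (V(G).Finite → MinDegreeAtLeast G 3 → ∀ x y : V(G),
      (¬ Bipartite G →
        Tendsto (fun n : ℕ => q hf h2 n x y) atTop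
          (𝓝 ((deg G y : ℝ) / (Nat.card (OEdge G) : ℝ)))) ∧
      (Bipartite G →
        Tendsto (fun n : ℕ => q hf h2 (2 * n + NBRW.dist G x y % 2) x y) atTop
          (𝓝 (2 * (deg G y : ℝ) / (Nat.card (OEdge G) : ℝ))))) ∧
    (V(G).Infinite → ∀ x y : V(G),
      Tendsto (fun n : ℕ => q hf h2 n x y) atTop (𝓝 0)) :=
  ⟨fun hV x y => tendsto_cesaro_q hf h2 hc hV x y,
    fun hV h3 x y => ⟨fun hb => tendsto_q_of_not_bipartite hf h2 hc hV h3 hb x y,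
      fun hb => tendsto_q_of_bipartite hf h2 hc hV h3 hb x y⟩,
    fun hV x y => tendsto_q_of_infinite hf h2 hc hV x y⟩
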